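/- **Theorem 2 (Multivariable Convex Trace Functions).** Let $I_1,\dots,I_n\subset\mathbb R$ be intervals and let $f$ be a continuous convex real function on the cube $I=I_1\times\cdots\times I_n\subset\mathbb R^n$. Let $A$ be a $C^*$-algebra and let $A_1,\dots,A_n$ be mutually commuting $C^*$-subalgebras of $A$, i.e. $ab=ba$ whenever $a\in A_i$, $b\in A_j$ and $i\neq j$. If $A$ has no unit, assume $f(0)=0$. Let $(A_i)_{sa}^{I_i}$ be the set of self-adjoint elements of $A_i$ whose spectra are contained in $I_i$; spectra are taken in $A$ if $A$ is unital (the $A_i$ need not contain the unit), and in the unitization of $A$ otherwise. For $\underline x=(x_1,\dots,x_n)$ with $x_i\in(A_i)_{sa}^{I_i}$ for each $i$, let $f(\underline x)\in A$ be given by the joint continuous functional calculus, i.e. the unital $*$-homomorphism from the continuous functions on the product of the spectra of the $x_i$ into $A$ (or into the unitization of $A$, if $A$ has no unit) that sends the $i$-th coordinate function to $x_i$. A trace on $A$ is a map $\tau\colon A_+\to[0,\infty]$ that is additive and positively homogeneous (with $0\cdot\infty=0$) and satisfies $\tau(x^*x)=\tau(xx^*)$ for all $x\in A$. It is finite if $\tau(a)<\infty$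 for all $a\in A_+$, in which case it is extended to self-adjoint elements by $\tau(a)=\tau(a_+)-\tau(a_-)$; it is densely defined if $\{a\in A_+:\tau(a)<\infty\}$ is dense in $A_+$. 1. If $\tau$ is a finite trace on $A$, then the function $(x_1,\dots,x_n)\mapsto\tau(f(x_1,\dots,x_n))\in\mathbb R$ is convex on the (convex) set of $n$-tuples $\bigoplus_i (A_i)_{sa}^{I_i}$. 2. If $\tau$ is a densely defined trace on $A$ that is lower semicontinuous on $A_+$, and $f\ge 0$ on $I$, then the function $(x_1,\dots,x_n)\mapsto\tau(f(x_1,\dots,x_n))\in[0,\infty]$ is convex on $\bigoplus_i (A_i)_{sa}^{I_i}$; it may take the value $\infty$. -/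

import Mathlib

open scoped ENNReal NNReal

noncomputable section

namespace TraceConvexity

/-! ### Joint continuous functional calculus -/

section Calculus

variable {n : ℕ} {A : Type*} [CStarAlgebra A]

/-- The product of the (real) spectra of the elements `x 0, …, x (n - 1)`. -/
def specBox (x : Fin n → A) : Set (Fin n → ℝ) :=
  Set.univ.pi fun i => spectrum ℝ (x i)

/-- The `i`-th coordinate function `t ↦ t i` on the product of the spectra. -/
def coord (x : Fin n → A) (i : Fin n) : C(specBox x, ℂ) where
  toFun t := ((t : Fin n → ℝ) i : ℂ)
  continuous_toFun := Complex.continuous_ofReal.comp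
    ((continuous_apply i).comp continuous_subtype_val)

/-- The restriction to the product of the spectra of a real function that is continuous there. -/
def restrictBox (x : Fin n → A) (f : (Fin n → ℝ) → ℝ) (hf : ContinuousOn f (specBox x)) :
    C(specBox x, ℂ) where
  toFun t := (f t : ℂ)
  continuous_toFun := Complex.continuous_ofReal.comp hf.domRestrict

open Classical in
/-- The element `f(x₁, …, xₙ)` of a unital C⋆-algebra, for commuting self-adjoint `xᵢ`: the image
of `f` under the unital `⋆`-homomorphism from the continuous functions on the product of the
spectra that sends the `i`-th coordinate function to `xᵢ`. This homomorphism exists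
(`exists_starAlgHom`) and is unique (`starAlgHom_ext`). -/
def jointCFC (x : Fin n → A) (f : (Fin n → ℝ) → ℝ) : A :=
  if h : (∃ φ : C(specBox x, ℂ) →⋆ₐ[ℂ] A, ∀ i, φ (coord x i) = x i) ∧
      ContinuousOn f (specBox x) then
    h.1.choose (restrictBox x f h.2)
  else 0

theorem isCompact_specBox (x : Fin n → A) : IsCompact (specBox x) :=
  isCompact_univ_pi fun i => spectrum.isCompact (𝕜 := ℝ) (x i)

open scoped CStarAlgebra in
theorem starAlgHom_ext {D : Type*} [CStarAlgebra D] (x : Fin n → A)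
    {φ ψ : C(specBox x, ℂ) →⋆ₐ[ℂ] D} (h : ∀ i, φ (coord x i) = ψ (coord x i)) : φ = ψ := by
  have : CompactSpace (specBox x) := isCompact_iff_compactSpace.mp (isCompact_specBox x)
  have hsep : (StarAlgebra.adjoin ℂ (Set.range (coord x))).SeparatesPoints := by
    intro s t hst
    have : ∃ i, (s : Fin n → ℝ) i ≠ (t : Fin n → ℝ) i := by
      by_contra hcon
      push Not at hcon
      exact hst (Subtype.ext (funext hcon))
    obtain ⟨i, hi⟩ := this
    refine ⟨coord x i, ⟨coord x i, StarAlgebra.subset_adjoin _ _ ⟨i, rfl⟩, rfl⟩, ?_⟩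
    simpa [coord] using hi
  have htop := ContinuousMap.starSubalgebra_topologicalClosure_eq_top_of_separatesPoints _ hsep
  have hφ : Continuous φ := map_continuous φ
  have hψ : Continuous ψ := map_continuous ψ
  have hle : StarAlgebra.adjoin ℂ (Set.range (coord x)) ≤ StarAlgHom.equalizer φ ψ := by
    apply StarAlgebra.adjoin_le
    rintro _ ⟨i, rfl⟩
    exact h i
  have hcl : (StarAlgebra.adjoin ℂ (Set.range (coord x))).topologicalClosure ≤
      StarAlgHom.equalizer φ ψ :=
    StarSubalgebra.topologicalClosure_minimal hle (isClosed_eq hφ hψ)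
  ext1 g
  have : g ∈ (StarAlgebra.adjoin ℂ (Set.range (coord x))).topologicalClosure := by
    rw [htop]; trivial
  exact hcl this

theorem exists_starAlgHom (x : Fin n → A) (hsa : ∀ i, IsSelfAdjoint (x i))
    (hcomm : ∀ i j, Commute (x i) (x j)) :
    ∃ φ : C(specBox x, ℂ) →⋆ₐ[ℂ] A, ∀ i, φ (coord x i) = x i := by
  let S₀ : StarSubalgebra ℂ A := StarAlgebra.adjoin ℂ (Set.range x)
  have hcS : IsMulCommutative S₀ := StarAlgebra.isMulCommutative_adjoin ℂ
    (by rintro _ ⟨i, rfl⟩ _ ⟨j, rfl⟩; exact hcomm i j)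
    (by rintro _ ⟨i, rfl⟩ _ ⟨j, rfl⟩; rw [(hsa j).star_eq]; exact hcomm i j)
  let S : StarSubalgebra ℂ A := S₀.topologicalClosure
  have hmc : ∀ a b : S₀, a * b = b * a := fun a b => mul_comm' a b
  have hS : IsClosed (S : Set A) := StarSubalgebra.isClosed_topologicalClosure _
  let cS : CStarAlgebra S := inferInstance
  let : CommCStarAlgebra S :=
    { cS with mul_comm := (StarSubalgebra.commRingTopologicalClosure S₀ hmc).mul_comm }
  have hx : ∀ i, x i ∈ S := fun i =>
    S₀.le_topologicalClosure (StarAlgebra.subset_adjoin _ _ ⟨i, rfl⟩)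
  have hχ : ∀ (χ : WeakDual.characterSpace ℂ S) i,
      ((χ ⟨x i, hx i⟩).re : ℂ) = χ ⟨x i, hx i⟩ := by
    intro χ i
    have h1 : star (⟨x i, hx i⟩ : S) = ⟨x i, hx i⟩ := Subtype.ext (hsa i).star_eq
    have h2 : star (χ ⟨x i, hx i⟩) = χ ⟨x i, hx i⟩ := by rw [← map_star, h1]
    exact Complex.conj_eq_iff_re.mp h2
  have hmem : ∀ (χ : WeakDual.characterSpace ℂ S),
      (fun i => (χ ⟨x i, hx i⟩).re) ∈ specBox x := by
    intro χ i _
    have h1 : χ ⟨x i, hx i⟩ ∈ spectrum ℂ (⟨x i, hx i⟩ : S) :=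
      WeakDual.CharacterSpace.apply_mem_spectrum χ _
    rw [StarSubalgebra.spectrum_eq, ← hχ χ i] at h1
    exact (spectrum.algebraMap_mem_iff ℂ).mp h1
  let q : C(WeakDual.characterSpace ℂ S, specBox x) :=
    { toFun := fun χ => ⟨_, hmem χ⟩
      continuous_toFun := by
        refine Continuous.subtype_mk (continuous_pi fun i => ?_) _
        exact Complex.continuous_re.comp (WeakDual.gelfandTransform ℂ S ⟨x i, hx i⟩).continuous }
  refine ⟨(S.subtype.comp ((gelfandStarTransform S).symm : _ →⋆ₐ[ℂ] S)).comp
    (q.compStarAlgHom' ℂ ℂ), fun i => ?_⟩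
  have : (q.compStarAlgHom' ℂ ℂ) (coord x i) = gelfandStarTransform S ⟨x i, hx i⟩ := by
    ext χ
    exact hχ χ i
  simp [this]

theorem jointCFC_eq (x : Fin n → A) (f : (Fin n → ℝ) → ℝ) (hf : ContinuousOn f (specBox x))
    (φ : C(specBox x, ℂ) →⋆ₐ[ℂ] A) (hφ : ∀ i, φ (coord x i) = x i) :
    jointCFC x f = φ (restrictBox x f hf) := by
  have h : (∃ φ : C(specBox x, ℂ) →⋆ₐ[ℂ] A, ∀ i, φ (coord x i) = x i) ∧
      ContinuousOn f (specBox x) := ⟨⟨φ, hφ⟩, hf⟩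
  rw [jointCFC, dif_pos h, starAlgHom_ext x (φ := h.1.choose) (ψ := φ)
    fun i => (h.1.choose_spec i).trans (hφ i).symm]

end Calculus

/-- The element `f(x₁, …, xₙ)` of a C⋆-algebra that need not have a unit, for commuting
self-adjoint `xᵢ` and `f 0 = 0`: it is computed in the unitization, where its scalar part is
`f 0 = 0` (`fst_jointCFC_inr`), and so lies in `A`. -/
def jointCFCₙ {n : ℕ} {A : Type*} [NonUnitalCStarAlgebra A] (x : Fin n → A)
    (f : (Fin n → ℝ) → ℝ) : A :=
  (jointCFC (fun i => (x i : Unitization ℂ A)) f).snd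

theorem fst_jointCFC_inr {n : ℕ} {A : Type*} [NonUnitalCStarAlgebra A] (x : Fin n → A)
    (hsa : ∀ i, IsSelfAdjoint (x i)) (hcomm : ∀ i j, Commute (x i) (x j))
    (f : (Fin n → ℝ) → ℝ)
    (hf : ContinuousOn f (specBox fun i => (x i : Unitization ℂ A))) :
    (jointCFC (fun i => (x i : Unitization ℂ A)) f).fst = (f 0 : ℂ) := by
  obtain ⟨φ, hφ⟩ := exists_starAlgHom (fun i => (x i : Unitization ℂ A))
    (fun i => (hsa i).inr ℂ)
    (fun i j => by
      have := congrArg (Unitization.inr (R := ℂ)) (hcomm i j).eq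
      simpa [Commute, SemiconjBy] using this)
  have h0 : (0 : Fin n → ℝ) ∈ specBox fun i => (x i : Unitization ℂ A) := by
    intro i _
    change (0 : ℝ) ∈ spectrum ℝ (x i : Unitization ℂ A)
    rw [← Unitization.quasispectrum_eq_spectrum_inr' ℝ ℂ (x i)]
    exact quasispectrum.zero_mem ℝ (x i)
  let p : Unitization ℂ A →⋆ₐ[ℂ] ℂ :=
    { Unitization.fstHom ℂ A with map_star' := fun a => Unitization.fst_star a }
  let ev : C(specBox fun i => (x i : Unitization ℂ A), ℂ) →⋆ₐ[ℂ] ℂ :=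
    { toFun := fun g => g ⟨0, h0⟩
      map_one' := rfl
      map_mul' := fun _ _ => rfl
      map_zero' := rfl
      map_add' := fun _ _ => rfl
      commutes' := fun _ => rfl
      map_star' := fun _ => rfl }
  have hev : p.comp φ = ev := by
    refine starAlgHom_ext _ fun i => ?_
    change (φ (coord _ i)).fst = ((0 : ℝ) : ℂ)
    rw [hφ i]
    simp
  rw [jointCFC_eq _ f hf φ hφ]
  exact DFunLike.congr_fun hev (restrictBox _ f hf)

/-! ### Traces -/

section Traces

variable {A : Type*} [NonUnitalCStarAlgebra A] [PartialOrder A]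

/-- A trace on `A`: an additive, positively homogeneous map `τ` from the positive cone of `A` to
`[0, ∞]` with `τ (x⋆ x) = τ (x x⋆)` for all `x`. Only the values of `τ` on positive elements
matter. -/
structure IsTrace (τ : A → ℝ≥0∞) : Prop where
  map_add : ∀ a b : A, 0 ≤ a → 0 ≤ b → τ (a + b) = τ a + τ b
  map_smul : ∀ (c : ℝ≥0) (a : A), 0 ≤ a → τ (c • a) = c * τ a
  map_star_mul_self : ∀ x : A, τ (star x * x) = τ (x * star x)

/-- `τ` is finite on the whole positive cone. -/
def IsFiniteTrace (τ : A → ℝ≥0∞) : Prop :=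
  ∀ a : A, 0 ≤ a → τ a < ∞

/-- The positive elements with finite trace are dense in the positive cone. -/
def IsDenselyDefined (τ : A → ℝ≥0∞) : Prop :=
  {a : A | 0 ≤ a} ⊆ closure {a : A | 0 ≤ a ∧ τ a < ∞}

/-- The real-valued extension of a finite trace to the self-adjoint elements `a = a⁺ - a⁻`. -/
def realTrace [StarOrderedRing A] (τ : A → ℝ≥0∞) (a : A) : ℝ :=
  (τ a⁺).toReal - (τ a⁻).toReal

end Traces

/-! ### Tuples from commuting subalgebras -/

/-- Elements of `S i` and of `S j` commute whenever `i ≠ j`. -/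
def MutuallyCommuting {n : ℕ} {A : Type*} [NonUnitalCStarAlgebra A]
    (S : Fin n → NonUnitalStarSubalgebra ℂ A) : Prop :=
  ∀ i j, i ≠ j → ∀ a ∈ S i, ∀ b ∈ S j, Commute a b

/-- The tuples of self-adjoint elements `x i ∈ S i` with spectrum contained in `I i`, in a unital
C⋆-algebra; the `S i` need not contain the unit. -/
def saTuples {n : ℕ} {A : Type*} [CStarAlgebra A] (S : Fin n → NonUnitalStarSubalgebra ℂ A)
    (I : Fin n → Set ℝ) : Set (Fin n → A) :=
  {x | ∀ i, x i ∈ S i ∧ IsSelfAdjoint (x i) ∧ spectrum ℝ (x i) ⊆ I i}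

/-- The same in a C⋆-algebra that need not have a unit: `quasispectrum ℝ (x i)` is the spectrum of
`x i` in the unitization. -/
def saTuplesₙ {n : ℕ} {A : Type*} [NonUnitalCStarAlgebra A]
    (S : Fin n → NonUnitalStarSubalgebra ℂ A) (I : Fin n → Set ℝ) : Set (Fin n → A) :=
  {x | ∀ i, x i ∈ S i ∧ IsSelfAdjoint (x i) ∧ quasispectrum ℝ (x i) ⊆ I i}

end TraceConvexity

end

/-! Let z = ax + by with a, b ≥ 0 and a + b = 1. An affine ℓ ≤ f satisfies ℓ(z) = aℓ(x) + bℓ(y) ≤ a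
f(x) + b f(y), because the functional calculus of an affine function is affine in the tuple. One
minorant does not recover f(z), and f need not be operator convex, so the trace has to be used.

Suppose f ≥ 0. Finitely many affine minorants ℓ_k, weighted by a partition of unity h_k, give (f -
ε)⁺ ≤ ∑ h_k ℓ_k (`exists_affine_combination_ge`). With g_k = √h_k(z), which commutes with ℓ_k(z), it
follows that (f - ε)⁺(z) ≤ ∑ g_k ℓ_k(z) g_k ≤ ∑ g_k (a f(x) + b f(y)) g_k. The trace removes the
weights: for p = √f(x), τ(g_k p² g_k) = τ(p g_k² p), and ∑ g_k² ≤ 1, so τ(∑ g_k f(x) g_k) ≤ τ(f(x))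
(`sum_conjugate_le`); likewise for y. Lower semicontinuity of τ then allows ε → 0.

Everything else reduces to this case. Without a unit, τ is extended to the unitization by ∞ off A,
which is again a lower semicontinuous trace. A finite trace is automatically bounded, hence lower
semicontinuous, and a signed f is made nonnegative by subtracting a constant. Without a unit the
condition f(0) = 0 must survive, so a linear function is subtracted instead, up to a small uniform
error. -/

noncomputable section

namespace TraceConvexity

/-! ### Affine minorants of convex functions -/

/-- On a compact convex set, the truncation `(f - ε)⁺` of a continuous convex function
`f` is dominated by a combination of affine minorants of `f` whose coefficients are nonnegative
continuous functions of sum at most one. -/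
theorem exists_affine_combination_ge.{u} {E : Type u} [NormedAddCommGroup E] [NormedSpace ℝ E]
    {K : Set E} (hK : IsCompact K) {f : E → ℝ} (hf : ContinuousOn f K) (hconv : ConvexOn ℝ K f)
    {ε : ℝ} (hε : 0 < ε) :
    ∃ (ι : Type u) (_ : Fintype ι) (h : ι → E → ℝ) (l : ι → E →L[ℝ] ℝ) (c : ι → ℝ),
      (∀ k, Continuous (h k)) ∧ (∀ k t, 0 ≤ h k t) ∧ (∀ t, ∑ k, h k t ≤ 1) ∧
      (∀ k, ∀ t ∈ K, l k t + c k ≤ f t) ∧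
      ∀ t ∈ K, max (f t - ε) 0 ≤ ∑ k, h k t * (l k t + c k) := by
  have hF : ContinuousOn (fun t => max (f t - ε) 0) K :=
    (hf.sub continuousOn_const).sup continuousOn_const
  have hs : IsCompact (K ∩ f ⁻¹' Set.Ici ε) :=
    hK.of_isClosed_subset (hf.preimage_isClosed_of_isClosed hK.isClosed isClosed_Ici)
      Set.inter_subset_left
  have key : ∀ t : (K ∩ f ⁻¹' Set.Ici ε : Set E), ∃ (l : E →L[ℝ] ℝ) (c : ℝ) (U : Set E),
      (∀ s ∈ K, l s + c ≤ f s) ∧ IsOpen U ∧ (t : E) ∈ U ∧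
        ∀ s ∈ U ∩ K, max (f s - ε) 0 ≤ l s + c := by
    rintro ⟨t, htK, htε⟩
    have htε : ε ≤ f t := htε
    -- Since f t ≥ ε > 0, the truncation lies strictly below f at t. This leaves room for a minorant
    -- that beats it at t, hence near t by continuity.
    have hlt : max (f t - ε) 0 < f t := by
      rw [max_lt_iff]; constructor <;> linarith
    obtain ⟨r, hr, hr'⟩ := exists_between hlt
    obtain ⟨l, c, hle, heq⟩ := hconv.exists_affine_le_of_lt (𝕜 := ℝ) htK hr' hK.isClosed
      hf.lowerSemicontinuousOn
    have hl : ContinuousOn (fun s => l s + c) K := by fun_prop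
    have hev : ∀ᶠ s in nhdsWithin t K, max (f s - ε) 0 < l s + c :=
      (hF t htK).eventually_lt (hl t htK) (by
        have : l t + c = r := heq
        simpa only [this] using hr)
    obtain ⟨U, hU, htU, hUK⟩ := mem_nhdsWithin.mp hev
    exact ⟨l, c, U, fun s hs => hle ⟨s, hs⟩, hU, htU, fun s hs => (hUK hs).le⟩
  choose l c U hle hU htU hUK using key
  obtain ⟨T, hT⟩ := hs.elim_finite_subcover U hU fun t ht => Set.mem_iUnion.mpr ⟨⟨t, ht⟩, htU _⟩
  obtain ⟨ρ, hρ⟩ := PartitionOfUnity.exists_isSubordinate_of_locallyFinite hs.isClosed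
    (fun k : T => U k) (fun k => hU k) (locallyFinite_of_finite _)
    (by simpa [Set.iUnion_subtype] using hT)
  refine ⟨T, inferInstance, fun k => ρ k, fun k => l k, fun k => c k, fun k => (ρ k).continuous,
    fun k t => ρ.nonneg k t, fun t => ?_, fun k => hle k, fun t ht => ?_⟩
  · rw [← finsum_eq_sum_of_fintype]
    exact ρ.sum_le_one t
  · have hterm : ∀ k, ρ k t * max (f t - ε) 0 ≤ ρ k t * (l k t + c k) := by
      intro k
      by_cases h0 : ρ k t = 0
      · simp [h0]
      · exact mul_le_mul_of_nonneg_left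
          (hUK k t ⟨hρ k (subset_tsupport _ h0), ht⟩) (ρ.nonneg k t)
    refine le_trans ?_ (Finset.sum_le_sum fun k _ => hterm k)
    rw [← Finset.sum_mul, ← finsum_eq_sum_of_fintype]
    -- Where f < ε the weights may sum to less than one, but there the truncation vanishes.
    by_cases hfε : ε ≤ f t
    · rw [ρ.sum_eq_one ⟨ht, hfε⟩, one_mul]
    · rw [max_eq_right (by linarith), mul_zero]

/-! ### Properties of the joint functional calculus -/

section Calculus

variable {n : ℕ} {A : Type*} [CStarAlgebra A]

/-- The entries of the tuple are self-adjoint and commute with each other. -/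
structure IsCommSelfAdjoint {n : ℕ} {A : Type*} [NonUnitalCStarAlgebra A] (x : Fin n → A) :
    Prop where
  isSelfAdjoint : ∀ i, IsSelfAdjoint (x i)
  commute : ∀ i j, Commute (x i) (x j)

namespace IsCommSelfAdjoint

variable {x : Fin n → A} {f g : (Fin n → ℝ) → ℝ}

theorem jointCFC_add (hx : IsCommSelfAdjoint x)
    (hf : ContinuousOn f (specBox x)) (hg : ContinuousOn g (specBox x)) :
    jointCFC x (fun t => f t + g t) = jointCFC x f + jointCFC x g := by
  obtain ⟨φ, hφ⟩ := exists_starAlgHom x hx.isSelfAdjoint hx.commute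
  rw [jointCFC_eq x _ hf φ hφ, jointCFC_eq x _ hg φ hφ,
    jointCFC_eq x (fun t => f t + g t) (hf.add hg) φ hφ,
    ← map_add]
  congr 1
  ext t
  simp [restrictBox]

theorem jointCFC_mul (hx : IsCommSelfAdjoint x)
    (hf : ContinuousOn f (specBox x)) (hg : ContinuousOn g (specBox x)) :
    jointCFC x (fun t => f t * g t) = jointCFC x f * jointCFC x g := by
  obtain ⟨φ, hφ⟩ := exists_starAlgHom x hx.isSelfAdjoint hx.commute
  rw [jointCFC_eq x _ hf φ hφ, jointCFC_eq x _ hg φ hφ,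
    jointCFC_eq x (fun t => f t * g t) (hf.mul hg) φ hφ,
    ← map_mul]
  congr 1
  ext t
  simp [restrictBox]

theorem jointCFC_const (hx : IsCommSelfAdjoint x)
    (c : ℝ) : jointCFC x (fun _ => c) = algebraMap ℝ A c := by
  obtain ⟨φ, hφ⟩ := exists_starAlgHom x hx.isSelfAdjoint hx.commute
  rw [jointCFC_eq x _ continuousOn_const φ hφ, IsScalarTower.algebraMap_apply ℝ ℂ A,
    ← AlgHomClass.commutes φ]
  congr 1

theorem jointCFC_coord (hx : IsCommSelfAdjoint x)
    (i : Fin n) : jointCFC x (fun t => t i) = x i := by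
  obtain ⟨φ, hφ⟩ := exists_starAlgHom x hx.isSelfAdjoint hx.commute
  rw [jointCFC_eq x _ (by fun_prop) φ hφ, ← hφ i]
  congr 1

theorem isSelfAdjoint_jointCFC (hx : IsCommSelfAdjoint x) (hf : ContinuousOn f (specBox x)) :
    IsSelfAdjoint (jointCFC x f) := by
  obtain ⟨φ, hφ⟩ := exists_starAlgHom x hx.isSelfAdjoint hx.commute
  rw [jointCFC_eq x _ hf φ hφ, IsSelfAdjoint, ← map_star]
  congr 1
  ext t
  simp [restrictBox]

theorem jointCFC_congr (hx : IsCommSelfAdjoint x)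
    (hf : ContinuousOn f (specBox x)) (h : Set.EqOn f g (specBox x)) :
    jointCFC x f = jointCFC x g := by
  obtain ⟨φ, hφ⟩ := exists_starAlgHom x hx.isSelfAdjoint hx.commute
  rw [jointCFC_eq x _ hf φ hφ, jointCFC_eq x _ (hf.congr h.symm) φ hφ]
  congr 1
  ext t
  simp [restrictBox, h t.2]

theorem jointCFC_const_mul (hx : IsCommSelfAdjoint x) (c : ℝ) (hf : ContinuousOn f (specBox x)) :
    jointCFC x (fun t => c * f t) = c • jointCFC x f := by
  rw [hx.jointCFC_mul continuousOn_const hf, hx.jointCFC_const, Algebra.smul_def]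

theorem jointCFC_sub (hx : IsCommSelfAdjoint x)
    (hf : ContinuousOn f (specBox x)) (hg : ContinuousOn g (specBox x)) :
    jointCFC x (fun t => f t - g t) = jointCFC x f - jointCFC x g := by
  rw [eq_sub_iff_add_eq, ← hx.jointCFC_add (f := fun t => f t - g t) (hf.sub hg) hg]
  simp

theorem jointCFC_sum (hx : IsCommSelfAdjoint x) {ι : Type*} (s : Finset ι) {F : ι → (Fin n → ℝ) → ℝ}
    (hF : ∀ k, ContinuousOn (F k) (specBox x)) :
    jointCFC x (fun t => ∑ k ∈ s, F k t) = ∑ k ∈ s, jointCFC x (F k) := by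
  classical
  induction s using Finset.induction_on with
  | empty => simpa using hx.jointCFC_const 0
  | insert k s hk ih =>
    simp only [Finset.sum_insert hk]
    rw [hx.jointCFC_add (hF k) (continuousOn_finsetSum _ fun k _ => hF k), ih]

theorem jointCFC_linear (hx : IsCommSelfAdjoint x) (l : (Fin n → ℝ) →L[ℝ] ℝ) :
    jointCFC x l = ∑ i, l (Pi.single i 1) • x i := by
  have h : (l : (Fin n → ℝ) → ℝ) = fun t => ∑ i, l (Pi.single i 1) * t i := by
    ext t
    conv_lhs => rw [← Finset.univ_sum_single t, map_sum]
    refine Finset.sum_congr rfl fun i _ => ?_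
    rw [mul_comm, ← smul_eq_mul, ← map_smul, ← Pi.single_smul, smul_eq_mul, mul_one]
  conv_lhs => rw [h]
  rw [hx.jointCFC_sum _ fun i => by fun_prop]
  refine Finset.sum_congr rfl fun i _ => ?_
  rw [hx.jointCFC_const_mul _ (by fun_prop), hx.jointCFC_coord]

/-- For fixed coefficients the right-hand side is affine in `x`; this is how a convex combination of
tuples passes through an affine minorant. -/
theorem jointCFC_affine (hx : IsCommSelfAdjoint x) (l : (Fin n → ℝ) →L[ℝ] ℝ) (c : ℝ) :
    jointCFC x (fun t => l t + c) = ∑ i, l (Pi.single i 1) • x i + algebraMap ℝ A c := by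
  rw [hx.jointCFC_add (by fun_prop) continuousOn_const, hx.jointCFC_linear, hx.jointCFC_const]

theorem norm_jointCFC_le (hx : IsCommSelfAdjoint x)
    (hf : ContinuousOn f (specBox x)) {ε : ℝ} (hε : 0 ≤ ε)
    (h : ∀ t ∈ specBox x, |f t| ≤ ε) : ‖jointCFC x f‖ ≤ ε := by
  obtain ⟨φ, hφ⟩ := exists_starAlgHom x hx.isSelfAdjoint hx.commute
  have : CompactSpace (specBox x) := isCompact_iff_compactSpace.mp (isCompact_specBox x)
  rw [jointCFC_eq x _ hf φ hφ]
  refine (NonUnitalStarAlgHom.norm_apply_le φ _).trans ((ContinuousMap.norm_le _ hε).mpr ?_)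
  intro t
  simpa [restrictBox] using h t t.2

theorem jointCFC_eq_sqrt_mul_sqrt (hx : IsCommSelfAdjoint x) (hf : ContinuousOn f (specBox x))
    (h : ∀ t ∈ specBox x, 0 ≤ f t) :
    jointCFC x f = jointCFC x (fun t => √(f t)) * jointCFC x (fun t => √(f t)) := by
  rw [← hx.jointCFC_mul hf.sqrt hf.sqrt]
  exact hx.jointCFC_congr hf fun t ht => (Real.mul_self_sqrt (h t ht)).symm

section Order

variable [PartialOrder A] [StarOrderedRing A]

theorem jointCFC_nonneg (hx : IsCommSelfAdjoint x)
    (hf : ContinuousOn f (specBox x)) (h : ∀ t ∈ specBox x, 0 ≤ f t) :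
    0 ≤ jointCFC x f := by
  rw [hx.jointCFC_eq_sqrt_mul_sqrt hf h]
  exact (hx.isSelfAdjoint_jointCFC hf.sqrt).mul_self_nonneg

theorem jointCFC_mono (hx : IsCommSelfAdjoint x)
    (hf : ContinuousOn f (specBox x)) (hg : ContinuousOn g (specBox x))
    (h : ∀ t ∈ specBox x, f t ≤ g t) : jointCFC x f ≤ jointCFC x g := by
  rw [← sub_nonneg, ← hx.jointCFC_sub hg hf]
  exact hx.jointCFC_nonneg (hg.sub hf) fun t ht => sub_nonneg.mpr (h t ht)

end Order

end IsCommSelfAdjoint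

/-- The spectrum of a convex combination of self-adjoint elements lies in the convex hull of their
spectra. -/
theorem spectrum_convexCombination_subset {x y : A} (hx : IsSelfAdjoint x) (hy : IsSelfAdjoint y)
    {a b : ℝ} (ha : 0 ≤ a) (hb : 0 ≤ b) (hab : a + b = 1) :
    spectrum ℝ (a • x + b • y) ⊆ convexHull ℝ (spectrum ℝ x ∪ spectrum ℝ y) := by
  -- For self-adjoint elements, scalar bounds in the spectral order are bounds on the spectrum, and
  -- they survive convex combinations.
  let _ := CStarAlgebra.spectralOrder A
  have := CStarAlgebra.spectralOrderedRing A
  rcases subsingleton_or_nontrivial A with hA | hA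
  · rw [spectrum.of_subsingleton]
    exact Set.empty_subset _
  have hz : IsSelfAdjoint (a • x + b • y) :=
    ((IsSelfAdjoint.all a).smul hx).add ((IsSelfAdjoint.all b).smul hy)
  have hU : IsCompact (spectrum ℝ x ∪ spectrum ℝ y) :=
    (spectrum.isCompact (𝕜 := ℝ) x).union (spectrum.isCompact (𝕜 := ℝ) y)
  have hne : (spectrum ℝ x ∪ spectrum ℝ y).Nonempty :=
    (ContinuousFunctionalCalculus.spectrum_nonempty x hx).inl
  have hlo : ∀ w ∈ ({x, y} : Set A),
      algebraMap ℝ A (sInf (spectrum ℝ x ∪ spectrum ℝ y)) ≤ w ∧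
      w ≤ algebraMap ℝ A (sSup (spectrum ℝ x ∪ spectrum ℝ y)) := by
    rintro w (rfl | rfl)
    · rw [algebraMap_le_iff_le_spectrum hx, le_algebraMap_iff_spectrum_le hx]
      exact ⟨fun r hr => csInf_le hU.bddBelow (Or.inl hr),
        fun r hr => le_csSup hU.bddAbove (Or.inl hr)⟩
    · rw [algebraMap_le_iff_le_spectrum hy, le_algebraMap_iff_spectrum_le hy]
      exact ⟨fun r hr => csInf_le hU.bddBelow (Or.inr hr),
        fun r hr => le_csSup hU.bddAbove (Or.inr hr)⟩
  have hcomb : ∀ r : ℝ, algebraMap ℝ A r = a • algebraMap ℝ A r + b • algebraMap ℝ A r := by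
    intro r; rw [← add_smul, hab, one_smul]
  have h1 : algebraMap ℝ A (sInf (spectrum ℝ x ∪ spectrum ℝ y)) ≤ a • x + b • y := by
    rw [hcomb]
    exact add_le_add (smul_le_smul_of_nonneg_left (hlo x (by simp)).1 ha)
      (smul_le_smul_of_nonneg_left (hlo y (by simp)).1 hb)
  have h2 : a • x + b • y ≤ algebraMap ℝ A (sSup (spectrum ℝ x ∪ spectrum ℝ y)) := by
    rw [hcomb (sSup _)]
    exact add_le_add (smul_le_smul_of_nonneg_left (hlo x (by simp)).2 ha)
      (smul_le_smul_of_nonneg_left (hlo y (by simp)).2 hb)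
  intro r hr
  rw [algebraMap_le_iff_le_spectrum hz] at h1
  rw [le_algebraMap_iff_spectrum_le hz] at h2
  exact (convex_convexHull ℝ _).ordConnected.out
    (subset_convexHull ℝ _ (hU.sInf_mem hne)) (subset_convexHull ℝ _ (hU.sSup_mem hne))
    ⟨h1 r hr, h2 r hr⟩

end Calculus

/-! ### Traces on the positive cone -/

namespace IsTrace

section NonUnital

variable {A : Type*} [NonUnitalCStarAlgebra A] [PartialOrder A] {τ : A → ℝ≥0∞}

theorem map_zero (hτ : IsTrace τ) : τ 0 = 0 := by
  simpa using hτ.map_smul 0 0 le_rfl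

variable [StarOrderedRing A]

theorem mono (hτ : IsTrace τ) {a b : A} (ha : 0 ≤ a) (hab : a ≤ b) : τ a ≤ τ b := by
  have h := hτ.map_add a (b - a) ha (sub_nonneg.mpr hab)
  rw [add_sub_cancel] at h
  rw [h]
  exact le_self_add

theorem map_sum (hτ : IsTrace τ) {ι : Type*} (s : Finset ι) {a : ι → A} (ha : ∀ k, 0 ≤ a k) :
    τ (∑ k ∈ s, a k) = ∑ k ∈ s, τ (a k) := by
  classical
  induction s using Finset.induction_on with
  | empty => simpa using hτ.map_zero
  | insert k s hk ih =>
    rw [Finset.sum_insert hk, Finset.sum_insert hk,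
      hτ.map_add _ _ (ha k) (Finset.sum_nonneg fun k _ => ha k), ih]

end NonUnital

/-! ### Trace inequalities in unital algebras -/

section Unital

variable {A : Type*} [CStarAlgebra A] [PartialOrder A] [StarOrderedRing A] {τ : A → ℝ≥0∞}

/-- Compressing by self-adjoint elements `g k` with `∑ k, g k ^ 2 ≤ 1` does not increase the
trace. -/
theorem sum_conjugate_le (hτ : IsTrace τ)
    {ι : Type*} [Fintype ι] {g : ι → A} (hg : ∀ k, IsSelfAdjoint (g k))
    (hsum : ∑ k, g k * g k ≤ 1) {p : A} (hp : IsSelfAdjoint p) :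
    τ (∑ k, g k * (p * p) * g k) ≤ τ (p * p) := by
  -- This is the trace identity for w = p g_k: w⋆w = g_k p² g_k and ww⋆ = p g_k² p.
  have hcyc : ∀ k, τ (g k * (p * p) * g k) = τ (p * (g k * g k) * p) := by
    intro k
    have h := hτ.map_star_mul_self (p * g k)
    rw [star_mul, (hg k).star_eq, hp.star_eq] at h
    simpa only [mul_assoc] using h
  have hpos : ∀ k, 0 ≤ g k * (p * p) * g k := fun k =>
    (hg k).conjugate_nonneg hp.mul_self_nonneg
  have hpos' : ∀ k, 0 ≤ p * (g k * g k) * p := fun k =>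
    hp.conjugate_nonneg (hg k).mul_self_nonneg
  rw [hτ.map_sum _ hpos, Finset.sum_congr rfl fun k _ => hcyc k, ← hτ.map_sum _ hpos',
    ← Finset.sum_mul, ← Finset.mul_sum]
  refine hτ.mono ?_ ?_
  · exact hp.conjugate_nonneg (Finset.sum_nonneg fun k _ => (hg k).mul_self_nonneg)
  · simpa using hp.conjugate_le_conjugate hsum

variable {n : ℕ} {x y : Fin n → A} {a b : ℝ≥0} {K : Set (Fin n → ℝ)} {f : (Fin n → ℝ) → ℝ}

/-- The operator inequality comes from affine minorants glued by functions of z; the trace is needed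
only to discard the gluing weights, which need not commute with f(x) or f(y). -/
theorem jointCFC_truncation_le (hτ : IsTrace τ)
    (hx : IsCommSelfAdjoint x) (hy : IsCommSelfAdjoint y)
    (hz : IsCommSelfAdjoint (a • x + b • y)) (hab : a + b = 1) (hK : IsCompact K)
    (hxK : specBox x ⊆ K) (hyK : specBox y ⊆ K) (hzK : specBox (a • x + b • y) ⊆ K)
    (hf : ContinuousOn f K) (hconv : ConvexOn ℝ K f) (hpos : ∀ t ∈ K, 0 ≤ f t)
    {ε : ℝ} (hε : 0 < ε) :
    τ (jointCFC (a • x + b • y) fun t => max (f t - ε) 0) ≤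
      a * τ (jointCFC x f) + b * τ (jointCFC y f) := by
  obtain ⟨ι, _, h, l, c, hcont, h0, h1, hle, hge⟩ := exists_affine_combination_ge hK hf hconv hε
  set z := a • x + b • y with hzdef
  let g : ι → A := fun k => jointCFC z fun t => √(h k t)
  have hgc : ∀ k, ContinuousOn (fun t => √(h k t)) (specBox z) := fun k =>
    (hcont k).continuousOn.sqrt
  have hgs : ∀ k, IsSelfAdjoint (g k) := fun k => hz.isSelfAdjoint_jointCFC (hgc k)
  have hgg : ∀ k, jointCFC z (h k) = g k * g k := fun k =>
    hz.jointCFC_eq_sqrt_mul_sqrt (hcont k).continuousOn fun t _ => h0 k t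
  have hsum : ∑ k, g k * g k ≤ 1 := by
    simp_rw [← hgg]
    rw [← hz.jointCFC_sum _ fun k => (hcont k).continuousOn, ← map_one (algebraMap ℝ A),
      ← hz.jointCFC_const 1]
    exact hz.jointCFC_mono (by fun_prop) continuousOn_const fun t _ => h1 t
  have hac : ∀ k (s : Set (Fin n → ℝ)), ContinuousOn (fun t => l k t + c k) s := fun k s => by
    fun_prop
  have haff : ∀ k, jointCFC z (fun t => l k t + c k) ≤ a • jointCFC x f + b • jointCFC y f := by
    intro k
    have heq : jointCFC z (fun t => l k t + c k) =
        a • jointCFC x (fun t => l k t + c k) + b • jointCFC y (fun t => l k t + c k) := by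
      rw [hz.jointCFC_affine, hx.jointCFC_affine, hy.jointCFC_affine]
      have hc : algebraMap ℝ A (c k) = a • algebraMap ℝ A (c k) + b • algebraMap ℝ A (c k) := by
        rw [← add_smul, hab, one_smul]
      conv_lhs => rw [hc]
      simp only [hzdef, Pi.add_apply, Pi.smul_apply, smul_add, Finset.sum_add_distrib,
        Finset.smul_sum, smul_comm (l k _)]
      abel
    rw [heq]
    exact add_le_add
      (smul_le_smul_of_nonneg_left (hx.jointCFC_mono (hac k _) (hf.mono hxK)
        fun t ht => hle k t (hxK ht)) a.2)
      (smul_le_smul_of_nonneg_left (hy.jointCFC_mono (hac k _) (hf.mono hyK)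
        fun t ht => hle k t (hyK ht)) b.2)
  have hFc : ContinuousOn (fun t => max (f t - ε) 0) (specBox z) :=
    ((hf.mono hzK).sub continuousOn_const).sup continuousOn_const
  have hmain : jointCFC z (fun t => max (f t - ε) 0) ≤
      a • (∑ k, g k * jointCFC x f * g k) + b • ∑ k, g k * jointCFC y f * g k := by
    calc jointCFC z (fun t => max (f t - ε) 0)
        ≤ jointCFC z (fun t => ∑ k, h k t * (l k t + c k)) :=
          hz.jointCFC_mono hFc (by fun_prop) fun t ht => hge t (hzK ht)
      _ = ∑ k, g k * jointCFC z (fun t => l k t + c k) * g k := by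
          rw [hz.jointCFC_sum _ fun k => by fun_prop]
          refine Finset.sum_congr rfl fun k _ => ?_
          rw [← hz.jointCFC_mul (hgc k) (hac k _),
            ← hz.jointCFC_mul (f := fun t => √(h k t) * (l k t + c k))
              ((hgc k).mul (hac k _)) (hgc k)]
          refine hz.jointCFC_congr (by fun_prop) fun t _ => ?_
          have := Real.mul_self_sqrt (h0 k t)
          linear_combination (-(l k t + c k)) * this
      _ ≤ ∑ k, g k * (a • jointCFC x f + b • jointCFC y f) * g k :=
          Finset.sum_le_sum fun k _ => (hgs k).conjugate_le_conjugate (haff k)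
      _ = _ := by
          simp only [mul_add, add_mul, Finset.sum_add_distrib, Finset.smul_sum, mul_smul_comm,
            smul_mul_assoc]
  have hbound : ∀ {w : Fin n → A}, IsCommSelfAdjoint w → specBox w ⊆ K →
      0 ≤ ∑ k, g k * jointCFC w f * g k ∧
        τ (∑ k, g k * jointCFC w f * g k) ≤ τ (jointCFC w f) := by
    intro w hw hwK
    have hwp : ∀ t ∈ specBox w, 0 ≤ f t := fun t ht => hpos t (hwK ht)
    have hwc := hf.mono hwK
    refine ⟨Finset.sum_nonneg fun k _ =>
      (hgs k).conjugate_nonneg (hw.jointCFC_nonneg hwc hwp), ?_⟩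
    rw [hw.jointCFC_eq_sqrt_mul_sqrt hwc hwp]
    exact hτ.sum_conjugate_le hgs hsum (hw.isSelfAdjoint_jointCFC hwc.sqrt)
  obtain ⟨hx0, hx1⟩ := hbound hx hxK
  obtain ⟨hy0, hy1⟩ := hbound hy hyK
  refine (hτ.mono (hz.jointCFC_nonneg hFc fun t _ => le_max_right _ _) hmain).trans ?_
  rw [hτ.map_add _ _ (smul_nonneg (zero_le (a := a)) hx0) (smul_nonneg (zero_le (a := b)) hy0),
    hτ.map_smul _ _ hx0, hτ.map_smul _ _ hy0]
  gcongr

/-- Convexity inequality for a lower semicontinuous trace and a nonnegative convex function. -/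
theorem jointCFC_convexCombination_le (hτ : IsTrace τ) (hlsc : LowerSemicontinuousOn τ {a | 0 ≤ a})
    (hx : IsCommSelfAdjoint x) (hy : IsCommSelfAdjoint y)
    (hz : IsCommSelfAdjoint (a • x + b • y)) (hab : a + b = 1) (hK : IsCompact K)
    (hxK : specBox x ⊆ K) (hyK : specBox y ⊆ K) (hzK : specBox (a • x + b • y) ⊆ K)
    (hf : ContinuousOn f K) (hconv : ConvexOn ℝ K f) (hpos : ∀ t ∈ K, 0 ≤ f t) :
    τ (jointCFC (a • x + b • y) f) ≤ a * τ (jointCFC x f) + b * τ (jointCFC y f) := by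
  -- Given r below the left side, lower semicontinuity keeps τ above r on positive elements within
  -- some δ of f(z). Truncating at δ / 2 moves f(z) by at most δ / 2 in norm.
  refine le_of_forall_lt fun r hr => ?_
  have hfz := hf.mono hzK
  have hev := hlsc _ (hz.jointCFC_nonneg hfz fun t ht => hpos t (hzK ht)) r hr
  obtain ⟨δ, hδ, hball⟩ := Metric.mem_nhdsWithin_iff.mp hev
  have hFc : ContinuousOn (fun t => max (f t - δ / 2) 0) (specBox (a • x + b • y)) :=
    (hfz.sub continuousOn_const).sup continuousOn_const
  refine lt_of_lt_of_le (hball ⟨?_, ?_⟩) (hτ.jointCFC_truncation_le hx hy hz hab hK hxK hyK hzK hf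
    hconv hpos (half_pos hδ))
  · rw [Metric.mem_ball, dist_eq_norm, ← hz.jointCFC_sub hFc hfz]
    refine (hz.norm_jointCFC_le (hFc.sub hfz) (half_pos hδ).le fun t ht => ?_).trans_lt
      (half_lt_self hδ)
    have := hpos t (hzK ht)
    rw [Pi.sub_apply, abs_le]
    rcases le_total (f t - δ / 2) 0 with h | h
    · simp only [max_eq_right h]; constructor <;> linarith
    · simp only [max_eq_left h]; constructor <;> linarith
  · exact hz.jointCFC_nonneg hFc fun t _ => le_max_right _ _

end Unital

end IsTrace

/-! ### Extension of a trace to the unitization -/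

section Unitization

variable {A : Type*}

open Classical in
/-- The extension of a trace to the unitization that is infinite off `A`. -/
def extendTrace (τ : A → ℝ≥0∞) (b : Unitization ℂ A) : ℝ≥0∞ :=
  if b.fst = 0 then τ b.snd else ∞

theorem extendTrace_of_fst_eq_zero (τ : A → ℝ≥0∞) {b : Unitization ℂ A} (hb : b.fst = 0) :
    extendTrace τ b = τ b.snd := if_pos hb

theorem extendTrace_of_fst_ne_zero (τ : A → ℝ≥0∞) {b : Unitization ℂ A} (hb : b.fst ≠ 0) :
    extendTrace τ b = ∞ := if_neg hb

theorem inr_snd_of_fst_eq_zero {b : Unitization ℂ A} (hb : b.fst = 0) :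
    ((b.snd : A) : Unitization ℂ A) = b := by
  ext <;> simp [hb]

variable [NonUnitalCStarAlgebra A]

open ComplexOrder in
theorem fst_nonneg {b : Unitization ℂ A} (h : 0 ≤ b) : 0 ≤ b.fst := by
  rw [StarOrderedRing.nonneg_iff] at h
  induction h using AddSubmonoid.closure_induction with
  | mem _ hs =>
    obtain ⟨s, rfl⟩ := hs
    simpa using star_mul_self_nonneg s.fst
  | zero => simp
  | add _ _ _ _ h₁ h₂ => simpa using add_nonneg h₁ h₂

variable [PartialOrder A] [StarOrderedRing A]

theorem snd_nonneg_of_fst_eq_zero {b : Unitization ℂ A} (h : 0 ≤ b) (hb : b.fst = 0) :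
    0 ≤ b.snd := by
  rwa [← Unitization.inr_nonneg_iff, inr_snd_of_fst_eq_zero hb]

/-- The scalar part is multiplicative, and nonnegative on positive elements. So a sum of positive
elements lies in A only if both summands do, and x⋆x and xx⋆ lie in A exactly when x does; the value
∞ is therefore consistent. -/
theorem IsTrace.extendTrace {τ : A → ℝ≥0∞} (hτ : IsTrace τ) : IsTrace (extendTrace τ) where
  map_add a b ha hb := by
    open ComplexOrder in
    by_cases h : a.fst = 0 ∧ b.fst = 0
    · rw [extendTrace_of_fst_eq_zero τ h.1, extendTrace_of_fst_eq_zero τ h.2,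
        extendTrace_of_fst_eq_zero τ (by simp [h.1, h.2]), Unitization.snd_add,
        hτ.map_add _ _ (snd_nonneg_of_fst_eq_zero ha h.1) (snd_nonneg_of_fst_eq_zero hb h.2)]
    · have h' : (a + b).fst ≠ 0 := by
        rwa [Unitization.fst_add, Ne, add_eq_zero_iff_of_nonneg (fst_nonneg ha) (fst_nonneg hb)]
      rw [extendTrace_of_fst_ne_zero τ h']
      by_cases ha' : a.fst = 0
      · rw [extendTrace_of_fst_ne_zero τ fun hb' => h ⟨ha', hb'⟩, add_top]
      · rw [extendTrace_of_fst_ne_zero τ ha', top_add]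
  map_smul c a ha := by
    rcases eq_or_ne c 0 with rfl | hc
    · rw [zero_smul, extendTrace_of_fst_eq_zero τ Unitization.fst_zero, Unitization.snd_zero,
        hτ.map_zero]
      simp
    by_cases h : a.fst = 0
    · rw [extendTrace_of_fst_eq_zero τ h, extendTrace_of_fst_eq_zero τ (by simp [h]),
        Unitization.snd_smul, hτ.map_smul _ _ (snd_nonneg_of_fst_eq_zero ha h)]
    · rw [extendTrace_of_fst_ne_zero τ h, extendTrace_of_fst_ne_zero τ (by simp [h, hc]),
        ENNReal.mul_top (by simpa using hc)]
  map_star_mul_self x := by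
    by_cases h : x.fst = 0
    · rw [extendTrace_of_fst_eq_zero τ (by simp [h]), extendTrace_of_fst_eq_zero τ (by simp [h])]
      simpa [h] using hτ.map_star_mul_self x.snd
    · rw [extendTrace_of_fst_ne_zero τ (by simp [h]), extendTrace_of_fst_ne_zero τ (by simp [h])]

/-- A is closed in the unitization, so a point off A has a neighbourhood where the value is ∞. Near
a point of A, either the value is ∞ or the semicontinuity of τ applies to the A-component. -/
theorem lowerSemicontinuousOn_extendTrace {τ : A → ℝ≥0∞}
    (hτ : LowerSemicontinuousOn τ {a | 0 ≤ a}) :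
    LowerSemicontinuousOn (extendTrace τ) {b | 0 ≤ b} := by
  intro b hb r hr
  have hfst : Continuous fun b : Unitization ℂ A => b.fst := Unitization.continuous_fst
  have hsnd : Continuous fun b : Unitization ℂ A => b.snd := Unitization.continuous_snd
  by_cases h : b.fst = 0
  · rw [extendTrace_of_fst_eq_zero τ h] at hr
    have hev := hτ _ (snd_nonneg_of_fst_eq_zero hb h) r hr
    rw [eventually_nhdsWithin_iff] at hev ⊢
    filter_upwards [hsnd.continuousAt.eventually hev] with c hc hc0
    by_cases hcf : c.fst = 0
    · rw [extendTrace_of_fst_eq_zero τ hcf]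
      exact hc (snd_nonneg_of_fst_eq_zero hc0 hcf)
    · rw [extendTrace_of_fst_ne_zero τ hcf]
      exact hr.trans_le le_top
  · rw [extendTrace_of_fst_ne_zero τ h] at hr
    filter_upwards [mem_nhdsWithin_of_mem_nhds
      (hfst.continuousAt.eventually_ne h)] with c hc
    rwa [extendTrace_of_fst_ne_zero τ hc]

end Unitization

/-! ### Finite traces -/

section Finite

variable {A : Type*} [NonUnitalCStarAlgebra A] [PartialOrder A] {τ : A → ℝ≥0∞}

theorem toReal_trace_add (hτ : IsTrace τ) (hfin : IsFiniteTrace τ)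
    {a b : A} (ha : 0 ≤ a) (hb : 0 ≤ b) :
    (τ (a + b)).toReal = (τ a).toReal + (τ b).toReal := by
  rw [hτ.map_add a b ha hb, ENNReal.toReal_add (hfin a ha).ne (hfin b hb).ne]

variable [StarOrderedRing A]

theorem realTrace_of_nonneg (hτ : IsTrace τ)
    {a : A} (ha : 0 ≤ a) : realTrace τ a = (τ a).toReal := by
  rw [realTrace, (CFC.posPart_eq_self a).mpr ha, (CFC.negPart_eq_zero_iff a).mpr ha, hτ.map_zero]
  simp

/-- The value does not depend on the decomposition: p - q = (p - q)⁺ - (p - q)⁻ rearranges to an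
equality of sums of positive elements, on which τ is additive and finite. -/
theorem realTrace_sub_of_nonneg (hτ : IsTrace τ) (hfin : IsFiniteTrace τ)
    {p q : A} (hp : 0 ≤ p) (hq : 0 ≤ q) :
    realTrace τ (p - q) = (τ p).toReal - (τ q).toReal := by
  have hsa : IsSelfAdjoint (p - q) := (IsSelfAdjoint.of_nonneg hp).sub (.of_nonneg hq)
  have h : (p - q)⁺ + q = p + (p - q)⁻ := by
    rw [← sub_eq_sub_iff_add_eq_add]
    exact CFC.posPart_sub_negPart _ hsa
  have h' := congrArg (fun a => (τ a).toReal) h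
  rw [toReal_trace_add hτ hfin (CFC.posPart_nonneg _) hq,
    toReal_trace_add hτ hfin hp (CFC.negPart_nonneg _)] at h'
  rw [realTrace]
  linarith

theorem realTrace_add (hτ : IsTrace τ) (hfin : IsFiniteTrace τ)
    {a b : A} (ha : IsSelfAdjoint a) (hb : IsSelfAdjoint b) :
    realTrace τ (a + b) = realTrace τ a + realTrace τ b := by
  have h : a + b = (a⁺ + b⁺) - (a⁻ + b⁻) := by
    conv_lhs => rw [← CFC.posPart_sub_negPart a ha, ← CFC.posPart_sub_negPart b hb]
    abel
  rw [h, realTrace_sub_of_nonneg hτ hfin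
      (add_nonneg (CFC.posPart_nonneg _) (CFC.posPart_nonneg _))
      (add_nonneg (CFC.negPart_nonneg _) (CFC.negPart_nonneg _)),
    toReal_trace_add hτ hfin (CFC.posPart_nonneg _) (CFC.posPart_nonneg _),
    toReal_trace_add hτ hfin (CFC.negPart_nonneg _) (CFC.negPart_nonneg _), realTrace, realTrace]
  ring

theorem realTrace_sub (hτ : IsTrace τ) (hfin : IsFiniteTrace τ)
    {a b : A} (ha : IsSelfAdjoint a) (hb : IsSelfAdjoint b) :
    realTrace τ (a - b) = realTrace τ a - realTrace τ b := by
  rw [eq_sub_iff_add_eq, ← realTrace_add hτ hfin (ha.sub hb) hb, sub_add_cancel]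

theorem realTrace_smul (hτ : IsTrace τ)
    (c : ℝ≥0) (a : A) : realTrace τ (c • a) = c * realTrace τ a := by
  rw [realTrace, realTrace, CFC.posPart_smul, CFC.negPart_smul,
    hτ.map_smul _ _ (CFC.posPart_nonneg _), hτ.map_smul _ _ (CFC.negPart_nonneg _)]
  simp [mul_sub]

/-- A finite trace is bounded on the positive cone. -/
theorem exists_toReal_trace_le (hτ : IsTrace τ) (hfin : IsFiniteTrace τ) :
    ∃ C : ℝ, 0 ≤ C ∧ ∀ a : A, 0 ≤ a → (τ a).toReal ≤ C * ‖a‖ := by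
  -- Otherwise there are positive unit vectors x_k with τ(x_k) > 4^k. The series ∑ 2^(-k) x_k
  -- converges and dominates each of its terms, so its trace exceeds 2^k for every k.
  by_contra! hcon
  have hlarge : ∀ k : ℕ, ∃ a : A, 0 ≤ a ∧ ‖a‖ = 1 ∧ (4 : ℝ) ^ k < (τ a).toReal := by
    intro k
    obtain ⟨a, ha, hlt⟩ := hcon (4 ^ k) (by positivity)
    have hne : a ≠ 0 := by
      rintro rfl
      simp [hτ.map_zero] at hlt
    have hpos : 0 < ‖a‖ := norm_pos_iff.mpr hne
    refine ⟨‖a‖₊⁻¹ • a, smul_nonneg zero_le ha, ?_, ?_⟩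
    · rw [NNReal.smul_def, norm_smul]
      simp [hpos.ne']
    · rw [hτ.map_smul _ _ ha]
      simpa using (lt_inv_mul_iff₀' hpos).mpr hlt
  choose x hx0 hx1 hx using hlarge
  have hnn : ∀ k, 0 ≤ ((2 : ℝ≥0) ^ k)⁻¹ • x k := fun k => smul_nonneg zero_le (hx0 k)
  have hsummable : Summable fun k : ℕ => ((2 : ℝ≥0) ^ k)⁻¹ • x k := by
    refine Summable.of_norm ?_
    have : ∀ k : ℕ, ‖((2 : ℝ≥0) ^ k)⁻¹ • x k‖ = ((2 : ℝ)⁻¹) ^ k := fun k => by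
      rw [NNReal.smul_def, norm_smul, hx1]
      simp
    simp_rw [this]
    exact summable_geometric_of_lt_one (by norm_num) (by norm_num)
  obtain ⟨k, hk⟩ := pow_unbounded_of_one_lt
    (τ (∑' k, ((2 : ℝ≥0) ^ k)⁻¹ • x k)).toReal (one_lt_two (α := ℝ))
  have hle := hτ.mono (hnn k) (hsummable.le_tsum k fun m _ => hnn m)
  have hle' := ENNReal.toReal_mono (hfin _ (tsum_nonneg hnn)).ne hle
  rw [hτ.map_smul _ _ (hx0 k), ENNReal.toReal_mul] at hle'
  have h2 : (2 : ℝ) ^ k < ((2 : ℝ) ^ k)⁻¹ * (τ (x k)).toReal := by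
    rw [lt_inv_mul_iff₀ (by positivity), ← mul_pow]
    norm_num
    exact hx k
  simp at hle'
  linarith

theorem exists_abs_realTrace_le (hτ : IsTrace τ) (hfin : IsFiniteTrace τ) :
    ∃ C : ℝ, 0 ≤ C ∧ ∀ a : A, IsSelfAdjoint a → |realTrace τ a| ≤ C * ‖a‖ := by
  obtain ⟨C, hC, hle⟩ := exists_toReal_trace_le hτ hfin
  refine ⟨C, hC, fun a ha => ?_⟩
  have h1 : (τ a⁺).toReal ≤ C * ‖a‖ := (hle _ (CFC.posPart_nonneg a)).trans
    (mul_le_mul_of_nonneg_left (CStarAlgebra.norm_posPart_le a) hC)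
  have h2 : (τ a⁻).toReal ≤ C * ‖a‖ := (hle _ (CFC.negPart_nonneg a)).trans
    (mul_le_mul_of_nonneg_left (CStarAlgebra.norm_negPart_le a) hC)
  have h3 : 0 ≤ (τ a⁺).toReal := ENNReal.toReal_nonneg
  have h4 : 0 ≤ (τ a⁻).toReal := ENNReal.toReal_nonneg
  rw [realTrace, abs_le]
  constructor <;> linarith

/-- Boundedness makes the real extension Lipschitz on the positive cone. -/
theorem lowerSemicontinuousOn_of_isFiniteTrace (hτ : IsTrace τ) (hfin : IsFiniteTrace τ) :
    LowerSemicontinuousOn τ {a | 0 ≤ a} := by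
  obtain ⟨C, hC, hle⟩ := exists_abs_realTrace_le hτ hfin
  have hcont : ContinuousOn (realTrace τ) {a : A | 0 ≤ a} := by
    refine (LipschitzOnWith.of_dist_le_mul (K := C.toNNReal) fun a ha b hb => ?_).continuousOn
    have ha' := IsSelfAdjoint.of_nonneg ha
    have hb' := IsSelfAdjoint.of_nonneg hb
    rw [Real.dist_eq, ← realTrace_sub hτ hfin ha' hb', dist_eq_norm, Real.coe_toNNReal _ hC]
    exact hle _ (ha'.sub hb')
  have heq : Set.EqOn τ (fun a => ENNReal.ofReal (realTrace τ a)) {a | 0 ≤ a} := fun a ha => by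
    simp only [realTrace_of_nonneg hτ ha]
    rw [ENNReal.ofReal_toReal (hfin a ha).ne]
  exact ((ENNReal.continuous_ofReal.comp_continuousOn hcont).congr heq).lowerSemicontinuousOn

theorem realTrace_le_of_trace_le (hτ : IsTrace τ) (hfin : IsFiniteTrace τ)
    {p q r : A} (hp : 0 ≤ p) (hq : 0 ≤ q) (hr : 0 ≤ r) {a b : ℝ≥0}
    (h : τ r ≤ a * τ p + b * τ q) :
    realTrace τ r ≤ a * realTrace τ p + b * realTrace τ q := by
  rw [realTrace_of_nonneg hτ hp, realTrace_of_nonneg hτ hq, realTrace_of_nonneg hτ hr]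
  have hap : a * τ p ≠ ∞ := ENNReal.mul_ne_top ENNReal.coe_ne_top (hfin p hp).ne
  have hbq : b * τ q ≠ ∞ := ENNReal.mul_ne_top ENNReal.coe_ne_top (hfin q hq).ne
  have h' := ENNReal.toReal_mono (ENNReal.add_ne_top.mpr ⟨hap, hbq⟩) h
  rw [ENNReal.toReal_add hap hbq] at h'
  simpa using h'

end Finite

/-! ### Finite traces and signed functions, with unit -/

section FiniteUnital

variable {A : Type*} [CStarAlgebra A] [PartialOrder A] [StarOrderedRing A] {τ : A → ℝ≥0∞}
  {n : ℕ} {x y : Fin n → A} {a b : ℝ≥0} {K : Set (Fin n → ℝ)} {f : (Fin n → ℝ) → ℝ}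

/-- Subtracting a lower bound m of f on K reduces to a nonnegative function. The constant
contributes τ(m·1) to both sides, as a + b = 1. -/
theorem realTrace_jointCFC_convexCombination_le (hτ : IsTrace τ) (hfin : IsFiniteTrace τ)
    (hx : IsCommSelfAdjoint x) (hy : IsCommSelfAdjoint y)
    (hz : IsCommSelfAdjoint (a • x + b • y)) (hab : a + b = 1) (hK : IsCompact K)
    (hxK : specBox x ⊆ K) (hyK : specBox y ⊆ K) (hzK : specBox (a • x + b • y) ⊆ K)
    (hf : ContinuousOn f K) (hconv : ConvexOn ℝ K f) :
    realTrace τ (jointCFC (a • x + b • y) f) ≤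
      a * realTrace τ (jointCFC x f) + b * realTrace τ (jointCFC y f) := by
  obtain ⟨m, hm⟩ := hK.bddBelow_image hf
  have hpos : ∀ t ∈ K, 0 ≤ f t - m := fun t ht => sub_nonneg.mpr (hm ⟨t, ht, rfl⟩)
  have hg : ContinuousOn (fun t => f t - m) K := hf.sub continuousOn_const
  have hgconv : ConvexOn ℝ K fun t => f t - m := hconv.sub (concaveOn_const m hconv.1)
  have hnonneg : ∀ {w : Fin n → A}, IsCommSelfAdjoint w → specBox w ⊆ K →
      0 ≤ jointCFC w fun t => f t - m := fun hw hwK =>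
    hw.jointCFC_nonneg (hg.mono hwK) fun t ht => hpos t (hwK ht)
  have htr : ∀ {w : Fin n → A}, IsCommSelfAdjoint w → specBox w ⊆ K →
      realTrace τ (jointCFC w fun t => f t - m) =
        realTrace τ (jointCFC w f) - realTrace τ (algebraMap ℝ A m) := by
    intro w hw hwK
    rw [hw.jointCFC_sub (hf.mono hwK) continuousOn_const, hw.jointCFC_const,
      realTrace_sub hτ hfin (hw.isSelfAdjoint_jointCFC (hf.mono hwK))
        (.algebraMap A (.all m))]
  have h := realTrace_le_of_trace_le hτ hfin (hnonneg hx hxK) (hnonneg hy hyK) (hnonneg hz hzK)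
    (hτ.jointCFC_convexCombination_le (lowerSemicontinuousOn_of_isFiniteTrace hτ hfin) hx hy hz hab
      hK hxK hyK hzK hg hgconv hpos)
  rw [htr hx hxK, htr hy hyK, htr hz hzK] at h
  have hab' : (a : ℝ) + b = 1 := by exact_mod_cast hab
  linear_combination h - realTrace τ (algebraMap ℝ A m) * hab'

end FiniteUnital

/-! ### Functional calculus and trace inequalities without unit -/

section NonUnital

variable {A : Type*} [NonUnitalCStarAlgebra A] {n : ℕ} {x y : Fin n → A} {a b : ℝ≥0}
  {K : Set (Fin n → ℝ)} {f g : (Fin n → ℝ) → ℝ}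

theorem IsCommSelfAdjoint.inr (hx : IsCommSelfAdjoint x) :
    IsCommSelfAdjoint fun i => (x i : Unitization ℂ A) where
  isSelfAdjoint i := (hx.isSelfAdjoint i).inr ℂ
  commute i j := by
    have := congrArg (Unitization.inr (R := ℂ)) (hx.commute i j).eq
    simpa [Commute, SemiconjBy] using this

theorem inr_convexCombination (x y : Fin n → A) (a b : ℝ≥0) :
    (fun i => ((a • x + b • y) i : Unitization ℂ A)) =
      a • (fun i => (x i : Unitization ℂ A)) + b • fun i => (y i : Unitization ℂ A) := by
  ext i <;> simp

theorem inr_jointCFCₙ (hx : IsCommSelfAdjoint x)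
    (hf : ContinuousOn f (specBox fun i => (x i : Unitization ℂ A))) (hf0 : f 0 = 0) :
    ((jointCFCₙ x f : A) : Unitization ℂ A) = jointCFC (fun i => (x i : Unitization ℂ A)) f := by
  refine inr_snd_of_fst_eq_zero ?_
  rw [fst_jointCFC_inr x hx.isSelfAdjoint hx.commute f hf, hf0, Complex.ofReal_zero]

theorem isSelfAdjoint_jointCFCₙ (hx : IsCommSelfAdjoint x)
    (hf : ContinuousOn f (specBox fun i => (x i : Unitization ℂ A))) :
    IsSelfAdjoint (jointCFCₙ x f) := by
  have := congrArg (fun b : Unitization ℂ A => b.snd) (hx.inr.isSelfAdjoint_jointCFC hf).star_eq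
  simpa [IsSelfAdjoint, jointCFCₙ] using this

theorem norm_jointCFCₙ_le (hx : IsCommSelfAdjoint x)
    (hf : ContinuousOn f (specBox fun i => (x i : Unitization ℂ A))) (hf0 : f 0 = 0) {ε : ℝ}
    (hε : 0 ≤ ε) (h : ∀ t ∈ specBox fun i => (x i : Unitization ℂ A), |f t| ≤ ε) :
    ‖jointCFCₙ x f‖ ≤ ε := by
  rw [← Unitization.norm_inr (𝕜 := ℂ), inr_jointCFCₙ hx hf hf0]
  exact hx.inr.norm_jointCFC_le hf hε h

theorem jointCFCₙ_add (hx : IsCommSelfAdjoint x)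
    (hf : ContinuousOn f (specBox fun i => (x i : Unitization ℂ A)))
    (hg : ContinuousOn g (specBox fun i => (x i : Unitization ℂ A))) :
    jointCFCₙ x (fun t => f t + g t) = jointCFCₙ x f + jointCFCₙ x g := by
  rw [jointCFCₙ, hx.inr.jointCFC_add hf hg, Unitization.snd_add, jointCFCₙ, jointCFCₙ]

theorem jointCFCₙ_sub (hx : IsCommSelfAdjoint x)
    (hf : ContinuousOn f (specBox fun i => (x i : Unitization ℂ A)))
    (hg : ContinuousOn g (specBox fun i => (x i : Unitization ℂ A))) :
    jointCFCₙ x (fun t => f t - g t) = jointCFCₙ x f - jointCFCₙ x g := by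
  rw [eq_sub_iff_add_eq, ← jointCFCₙ_add (f := fun t => f t - g t) hx (hf.sub hg) hg]
  simp

theorem jointCFCₙ_linear (hx : IsCommSelfAdjoint x) (l : (Fin n → ℝ) →L[ℝ] ℝ) :
    jointCFCₙ x l = ∑ i, l (Pi.single i 1) • x i := by
  have h : (∑ i, l (Pi.single i 1) • (x i : Unitization ℂ A)) =
      ((∑ i, l (Pi.single i 1) • x i : A) : Unitization ℂ A) := by
    simp_rw [← Unitization.inr_smul]
    exact (map_sum (Unitization.inrHom ℂ ℂ A) _ _).symm
  rw [jointCFCₙ, hx.inr.jointCFC_linear, h, Unitization.snd_inr]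

variable [PartialOrder A] [StarOrderedRing A] {τ : A → ℝ≥0∞}

theorem jointCFCₙ_nonneg (hx : IsCommSelfAdjoint x)
    (hf : ContinuousOn f (specBox fun i => (x i : Unitization ℂ A))) (hf0 : f 0 = 0)
    (h : ∀ t ∈ specBox fun i => (x i : Unitization ℂ A), 0 ≤ f t) : 0 ≤ jointCFCₙ x f := by
  rw [← Unitization.inr_nonneg_iff, inr_jointCFCₙ hx hf hf0]
  exact hx.inr.jointCFC_nonneg hf h

theorem trace_jointCFCₙ_convexCombination_le (hτ : IsTrace τ)
    (hlsc : LowerSemicontinuousOn τ {a | 0 ≤ a})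
    (hx : IsCommSelfAdjoint x) (hy : IsCommSelfAdjoint y)
    (hz : IsCommSelfAdjoint (a • x + b • y)) (hab : a + b = 1) (hK : IsCompact K)
    (hxK : (specBox fun i => (x i : Unitization ℂ A)) ⊆ K)
    (hyK : (specBox fun i => (y i : Unitization ℂ A)) ⊆ K)
    (hzK : (specBox fun i => ((a • x + b • y) i : Unitization ℂ A)) ⊆ K)
    (hf : ContinuousOn f K) (hconv : ConvexOn ℝ K f) (hpos : ∀ t ∈ K, 0 ≤ f t) (hf0 : f 0 = 0) :
    τ (jointCFCₙ (a • x + b • y) f) ≤ a * τ (jointCFCₙ x f) + b * τ (jointCFCₙ y f) := by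
  have hext : ∀ c : A, τ c = extendTrace τ (c : Unitization ℂ A) := fun c => by
    rw [extendTrace_of_fst_eq_zero τ (Unitization.fst_inr ℂ c), Unitization.snd_inr]
  rw [hext, hext (jointCFCₙ x f), hext (jointCFCₙ y f), inr_jointCFCₙ hx (hf.mono hxK) hf0,
    inr_jointCFCₙ hy (hf.mono hyK) hf0, inr_jointCFCₙ hz (hf.mono hzK) hf0]
  have hz' := hz.inr
  rw [inr_convexCombination] at hz' hzK ⊢
  exact hτ.extendTrace.jointCFC_convexCombination_le (lowerSemicontinuousOn_extendTrace hlsc)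
    hx.inr hy.inr hz' hab hK hxK hyK hzK hf hconv hpos

/-- Subtracting a constant would destroy f(0) = 0, so a linear function l is subtracted instead: the
trace of l(x) is additive in x, and (f - l)⁺ is convex, nonnegative and zero at 0. -/
theorem realTrace_jointCFCₙ_convexCombination_le (hτ : IsTrace τ) (hfin : IsFiniteTrace τ)
    (hx : IsCommSelfAdjoint x) (hy : IsCommSelfAdjoint y)
    (hz : IsCommSelfAdjoint (a • x + b • y)) (hab : a + b = 1) (hK : IsCompact K) (h0K : 0 ∈ K)
    (hxK : (specBox fun i => (x i : Unitization ℂ A)) ⊆ K)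
    (hyK : (specBox fun i => (y i : Unitization ℂ A)) ⊆ K)
    (hzK : (specBox fun i => ((a • x + b • y) i : Unitization ℂ A)) ⊆ K)
    (hf : ContinuousOn f K) (hconv : ConvexOn ℝ K f) (hf0 : f 0 = 0) :
    realTrace τ (jointCFCₙ (a • x + b • y) f) ≤
      a * realTrace τ (jointCFCₙ x f) + b * realTrace τ (jointCFCₙ y f) := by
  obtain ⟨C, hC, hbound⟩ := exists_abs_realTrace_le hτ hfin
  have hab' : (a : ℝ) + b = 1 := by exact_mod_cast hab
  -- up to a uniform error `δ`, the function `f` is a nonnegative convex function plus a linear one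
  have happrox : ∀ δ : ℝ, 0 < δ → realTrace τ (jointCFCₙ (a • x + b • y) f) ≤
      a * realTrace τ (jointCFCₙ x f) + b * realTrace τ (jointCFCₙ y f) + 2 * (C * δ) := by
    intro δ hδ
    -- The minorant takes the value -δ at 0 rather than f(0) = 0: if 0 lies on the boundary of K, f
    -- need not have a supporting affine function there.
    obtain ⟨l, c, hle, hlc⟩ := hconv.exists_affine_le_of_lt (𝕜 := ℝ) (a := -δ) h0K
      (by rw [hf0]; linarith) hK.isClosed hf.lowerSemicontinuousOn
    have hc : c = -δ := by simpa using hlc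
    have hle' : ∀ t ∈ K, l t ≤ f t + δ := fun t ht => by
      have : l t + c ≤ f t := hle ⟨t, ht⟩
      linarith
    -- As l ≤ f + δ on K, the difference f - (g + l) takes values in [-δ, 0] there.
    let g : (Fin n → ℝ) → ℝ := fun t => max (f t - l t) 0
    have hg : ContinuousOn g K := (hf.sub l.continuous.continuousOn).sup continuousOn_const
    have hgconv : ConvexOn ℝ K g :=
      (hconv.sub (l.toLinearMap.concaveOn hconv.1)).sup (convexOn_const 0 hconv.1)
    have hg0 : g 0 = 0 := by simp [g, hf0]
    have hgpos : ∀ t, 0 ≤ g t := fun t => le_max_right _ _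
    have hl : ContinuousOn l K := l.continuous.continuousOn
    have herr : ∀ {w : Fin n → A}, IsCommSelfAdjoint w →
        (specBox fun i => (w i : Unitization ℂ A)) ⊆ K →
        |realTrace τ (jointCFCₙ w f) -
          (realTrace τ (jointCFCₙ w g) + realTrace τ (jointCFCₙ w l))| ≤ C * δ := by
      intro w hw hwK
      have hfw := hf.mono hwK
      have hgw := hg.mono hwK
      have hlw := hl.mono hwK
      have hglw : ContinuousOn (fun t => g t + l t) _ := hgw.add hlw
      rw [← realTrace_add hτ hfin (isSelfAdjoint_jointCFCₙ hw hgw)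
          (isSelfAdjoint_jointCFCₙ hw hlw), ← jointCFCₙ_add hw hgw hlw,
        ← realTrace_sub hτ hfin (isSelfAdjoint_jointCFCₙ hw hfw)
          (isSelfAdjoint_jointCFCₙ hw hglw), ← jointCFCₙ_sub hw hfw hglw]
      refine (hbound _ (isSelfAdjoint_jointCFCₙ hw (hfw.sub hglw))).trans
        (mul_le_mul_of_nonneg_left ?_ hC)
      refine norm_jointCFCₙ_le hw (hfw.sub hglw) (by simp [hf0, hg0]) hδ.le fun t ht => ?_
      have := hle' t (hwK ht)
      simp only [g, Pi.sub_apply]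
      rw [abs_le]
      rcases le_total (f t - l t) 0 with h | h
      · rw [max_eq_right h]; constructor <;> linarith
      · rw [max_eq_left h]; constructor <;> linarith
    have hgnn : ∀ {w : Fin n → A}, IsCommSelfAdjoint w →
        (specBox fun i => (w i : Unitization ℂ A)) ⊆ K → 0 ≤ jointCFCₙ w g := fun hw hwK =>
      jointCFCₙ_nonneg hw (hg.mono hwK) hg0 fun t _ => hgpos t
    have hmain := realTrace_le_of_trace_le hτ hfin (hgnn hx hxK) (hgnn hy hyK) (hgnn hz hzK)
      (trace_jointCFCₙ_convexCombination_le hτ (lowerSemicontinuousOn_of_isFiniteTrace hτ hfin)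
        hx hy hz hab hK hxK hyK hzK hg hgconv (fun t _ => hgpos t) hg0)
    have hlin : realTrace τ (jointCFCₙ (a • x + b • y) l) =
        a * realTrace τ (jointCFCₙ x l) + b * realTrace τ (jointCFCₙ y l) := by
      have heq : jointCFCₙ (a • x + b • y) l = a • jointCFCₙ x l + b • jointCFCₙ y l := by
        rw [jointCFCₙ_linear hz, jointCFCₙ_linear hx, jointCFCₙ_linear hy]
        simp only [Pi.add_apply, Pi.smul_apply, smul_add, Finset.sum_add_distrib,
          Finset.smul_sum, smul_comm (l _)]
      rw [heq, realTrace_add hτ hfin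
          ((IsSelfAdjoint.all a).smul (isSelfAdjoint_jointCFCₙ hx (hl.mono hxK)))
          ((IsSelfAdjoint.all b).smul (isSelfAdjoint_jointCFCₙ hy (hl.mono hyK))),
        realTrace_smul hτ, realTrace_smul hτ]
    have ex := mul_le_mul_of_nonneg_left (abs_le.mp (herr hx hxK)).1 a.2
    have ey := mul_le_mul_of_nonneg_left (abs_le.mp (herr hy hyK)).1 b.2
    have ez := (abs_le.mp (herr hz hzK)).2
    simp only [NNReal.val_eq_coe] at ex ey
    -- The error at z costs Cδ, and those at x and y together cost (a + b)Cδ = Cδ.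
    linear_combination ez + hmain + hlin + ex + ey + C * δ * hab'
  refine le_of_forall_pos_le_add fun ε hε => ?_
  -- Using C + 1 instead of C avoids division by zero when C = 0.
  refine (happrox (ε / (2 * (C + 1))) (by positivity)).trans ?_
  have : 2 * (C * (ε / (2 * (C + 1)))) ≤ ε := by
    rw [show 2 * (C * (ε / (2 * (C + 1)))) = ε * (C / (C + 1)) by field_simp]
    exact mul_le_of_le_one_right hε.le ((div_le_one (by positivity)).mpr (by linarith))
  linarith

end NonUnital

/-! ### Tuples from commuting subalgebras -/

theorem isCompact_convexHull_real {s : Set ℝ} (hs : IsCompact s) :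
    IsCompact (convexHull ℝ s) := by
  rcases s.eq_empty_or_nonempty with rfl | hne
  · simp
  have h : convexHull ℝ s = Set.Icc (sInf s) (sSup s) := by
    refine Set.Subset.antisymm (convexHull_min ?_ (convex_Icc _ _)) ?_
    · exact fun r hr => ⟨csInf_le hs.bddBelow hr, le_csSup hs.bddAbove hr⟩
    · exact (convex_convexHull ℝ s).ordConnected.out (subset_convexHull ℝ s (hs.sInf_mem hne))
        (subset_convexHull ℝ s (hs.sSup_mem hne))
  rw [h]
  exact isCompact_Icc

/-! ### A compact convex box containing all the spectra -/

section Hull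

variable {n : ℕ} {A : Type*} [CStarAlgebra A] {x y : Fin n → A}

/-- The product of the convex hulls of the spectra of the entries of `x` and `y`. -/
def specHull (x y : Fin n → A) : Set (Fin n → ℝ) :=
  Set.univ.pi fun i => convexHull ℝ (spectrum ℝ (x i) ∪ spectrum ℝ (y i))

theorem isCompact_specHull (x y : Fin n → A) : IsCompact (specHull x y) :=
  isCompact_univ_pi fun i =>
    isCompact_convexHull_real
      ((spectrum.isCompact (𝕜 := ℝ) (x i)).union (spectrum.isCompact (𝕜 := ℝ) (y i)))

theorem convex_specHull (x y : Fin n → A) : Convex ℝ (specHull x y) :=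
  convex_pi fun _ _ => convex_convexHull ℝ _

theorem specBox_subset_specHull_left (x y : Fin n → A) : specBox x ⊆ specHull x y :=
  Set.pi_mono fun _ _ => Set.subset_union_left.trans (subset_convexHull ℝ _)

theorem specBox_subset_specHull_right (x y : Fin n → A) : specBox y ⊆ specHull x y :=
  Set.pi_mono fun _ _ => Set.subset_union_right.trans (subset_convexHull ℝ _)

theorem specBox_convexCombination_subset_specHull (hx : ∀ i, IsSelfAdjoint (x i))
    (hy : ∀ i, IsSelfAdjoint (y i)) {a b : ℝ≥0} (hab : a + b = 1) :
    specBox (a • x + b • y) ⊆ specHull x y :=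
  Set.pi_mono fun i _ => spectrum_convexCombination_subset (hx i) (hy i) a.2 b.2
    (by exact_mod_cast hab)

/-- The intervals need not be closed or bounded; the hull supplies a compact convex set inside their
product, on which f is still continuous and convex. -/
theorem specHull_subset {I : Fin n → Set ℝ} (hI : ∀ i, (I i).OrdConnected)
    (hx : ∀ i, spectrum ℝ (x i) ⊆ I i) (hy : ∀ i, spectrum ℝ (y i) ⊆ I i) :
    specHull x y ⊆ Set.univ.pi I :=
  Set.pi_mono fun i _ => convexHull_min (Set.union_subset (hx i) (hy i)) (hI i).convex

end Hull

section Tuples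

variable {n : ℕ} {I : Fin n → Set ℝ}

theorem mem_convexCombination {A : Type*} [NonUnitalCStarAlgebra A]
    {S : NonUnitalStarSubalgebra ℂ A} {u v : A} (hu : u ∈ S) (hv : v ∈ S) (a b : ℝ≥0) :
    a • u + b • v ∈ S := by
  have h : ∀ (c : ℝ≥0) {w : A}, w ∈ S → c • w ∈ S := fun c w hw => by
    have := SMulMemClass.smul_mem ((c : ℝ) : ℂ) hw
    rwa [Complex.coe_smul] at this
  exact S.add_mem (h a hu) (h b hv)

theorem isCommSelfAdjoint_of_mem {A : Type*} [NonUnitalCStarAlgebra A]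
    {S : Fin n → NonUnitalStarSubalgebra ℂ A} (hS : MutuallyCommuting S) {x : Fin n → A}
    (hmem : ∀ i, x i ∈ S i) (hsa : ∀ i, IsSelfAdjoint (x i)) : IsCommSelfAdjoint x where
  isSelfAdjoint := hsa
  commute i j := by
    rcases eq_or_ne i j with rfl | hij
    · exact Commute.refl _
    · exact hS i j hij _ (hmem i) _ (hmem j)

theorem isSelfAdjoint_convexCombination {A : Type*} [NonUnitalCStarAlgebra A] {u v : A}
    (hu : IsSelfAdjoint u) (hv : IsSelfAdjoint v) (a b : ℝ≥0) : IsSelfAdjoint (a • u + b • v) :=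
  ((IsSelfAdjoint.all a).smul hu).add ((IsSelfAdjoint.all b).smul hv)

theorem convex_saTuples {A : Type*} [CStarAlgebra A] (hI : ∀ i, (I i).OrdConnected)
    (S : Fin n → NonUnitalStarSubalgebra ℂ A) : Convex ℝ≥0 (saTuples S I) := by
  intro x hx y hy a b _ _ hab i
  refine ⟨mem_convexCombination (hx i).1 (hy i).1 a b,
    isSelfAdjoint_convexCombination (hx i).2.1 (hy i).2.1 a b, ?_⟩
  exact (spectrum_convexCombination_subset (hx i).2.1 (hy i).2.1 a.2 b.2
    (congrArg NNReal.toReal hab)).trans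
    (convexHull_min (Set.union_subset (hx i).2.2 (hy i).2.2) (hI i).convex)

theorem convex_saTuplesₙ {A : Type*} [NonUnitalCStarAlgebra A] (hI : ∀ i, (I i).OrdConnected)
    (S : Fin n → NonUnitalStarSubalgebra ℂ A) : Convex ℝ≥0 (saTuplesₙ S I) := by
  intro x hx y hy a b _ _ hab i
  refine ⟨mem_convexCombination (hx i).1 (hy i).1 a b,
    isSelfAdjoint_convexCombination (hx i).2.1 (hy i).2.1 a b, ?_⟩
  have hxi := (hx i).2.2
  have hyi := (hy i).2.2
  rw [Unitization.quasispectrum_eq_spectrum_inr' ℝ ℂ] at hxi hyi ⊢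
  rw [congrFun (inr_convexCombination x y a b) i]
  exact (spectrum_convexCombination_subset ((hx i).2.1.inr ℂ) ((hy i).2.1.inr ℂ) a.2 b.2
    (congrArg NNReal.toReal hab)).trans (convexHull_min (Set.union_subset hxi hyi) (hI i).convex)

theorem convexOn_real_iff_nnreal {E : Type*} [AddCommGroup E] [Module ℝ E] {s : Set E}
    {F : E → ℝ} : ConvexOn ℝ s F ↔ ConvexOn ℝ≥0 s F := by
  constructor
  · intro h
    exact ⟨fun x hx y hy a b _ _ hab => h.1 hx hy a.2 b.2 (by exact_mod_cast hab),
      fun x hx y hy a b _ _ hab => h.2 hx hy a.2 b.2 (by exact_mod_cast hab)⟩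
  · intro h
    refine ⟨fun x hx y hy a b ha hb hab => ?_, fun x hx y hy a b ha hb hab => ?_⟩
    · lift a to ℝ≥0 using ha
      lift b to ℝ≥0 using hb
      exact h.1 hx hy zero_le zero_le (by exact_mod_cast hab)
    · lift a to ℝ≥0 using ha
      lift b to ℝ≥0 using hb
      exact h.2 hx hy zero_le zero_le (by exact_mod_cast hab)

variable {f : (Fin n → ℝ) → ℝ}

section Unital

variable {A : Type*} [CStarAlgebra A] [PartialOrder A] [StarOrderedRing A]
  {S : Fin n → NonUnitalStarSubalgebra ℂ A} {τ : A → ℝ≥0∞}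

theorem convexOn_realTrace_jointCFC (hI : ∀ i, (I i).OrdConnected)
    (hf : ContinuousOn f (Set.univ.pi I)) (hconv : ConvexOn ℝ (Set.univ.pi I) f)
    (hS : MutuallyCommuting S) (hτ : IsTrace τ) (hfin : IsFiniteTrace τ) :
    ConvexOn ℝ (saTuples S I) fun x => realTrace τ (jointCFC x f) := by
  refine convexOn_real_iff_nnreal.mpr ⟨convex_saTuples hI S, fun x hx y hy a b ha hb hab => ?_⟩
  have hz := convex_saTuples hI S hx hy ha hb hab
  have hxI := specHull_subset hI (fun i => (hx i).2.2) fun i => (hy i).2.2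
  exact realTrace_jointCFC_convexCombination_le hτ hfin
    (isCommSelfAdjoint_of_mem hS (fun i => (hx i).1) fun i => (hx i).2.1)
    (isCommSelfAdjoint_of_mem hS (fun i => (hy i).1) fun i => (hy i).2.1)
    (isCommSelfAdjoint_of_mem hS (fun i => (hz i).1) fun i => (hz i).2.1) hab
    (isCompact_specHull x y) (specBox_subset_specHull_left x y)
    (specBox_subset_specHull_right x y)
    (specBox_convexCombination_subset_specHull (fun i => (hx i).2.1) (fun i => (hy i).2.1) hab)
    (hf.mono hxI) (hconv.subset hxI (convex_specHull x y))

theorem convexOn_trace_jointCFC (hI : ∀ i, (I i).OrdConnected)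
    (hf : ContinuousOn f (Set.univ.pi I)) (hconv : ConvexOn ℝ (Set.univ.pi I) f)
    (hpos : ∀ t ∈ Set.univ.pi I, 0 ≤ f t) (hS : MutuallyCommuting S) (hτ : IsTrace τ)
    (hlsc : LowerSemicontinuousOn τ {a | 0 ≤ a}) :
    ConvexOn ℝ≥0 (saTuples S I) fun x => τ (jointCFC x f) := by
  refine ⟨convex_saTuples hI S, fun x hx y hy a b ha hb hab => ?_⟩
  have hz := convex_saTuples hI S hx hy ha hb hab
  have hxI := specHull_subset hI (fun i => (hx i).2.2) fun i => (hy i).2.2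
  exact hτ.jointCFC_convexCombination_le hlsc
    (isCommSelfAdjoint_of_mem hS (fun i => (hx i).1) fun i => (hx i).2.1)
    (isCommSelfAdjoint_of_mem hS (fun i => (hy i).1) fun i => (hy i).2.1)
    (isCommSelfAdjoint_of_mem hS (fun i => (hz i).1) fun i => (hz i).2.1) hab
    (isCompact_specHull x y) (specBox_subset_specHull_left x y)
    (specBox_subset_specHull_right x y)
    (specBox_convexCombination_subset_specHull (fun i => (hx i).2.1) (fun i => (hy i).2.1) hab)
    (hf.mono hxI) (hconv.subset hxI (convex_specHull x y)) fun t ht => hpos t (hxI ht)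

end Unital

section NonUnital

variable {A : Type*} [NonUnitalCStarAlgebra A] {S : Fin n → NonUnitalStarSubalgebra ℂ A}

theorem specHull_inr_subset (hI : ∀ i, (I i).OrdConnected) {x y : Fin n → A}
    (hx : x ∈ saTuplesₙ S I) (hy : y ∈ saTuplesₙ S I) :
    specHull (fun i => (x i : Unitization ℂ A)) (fun i => (y i : Unitization ℂ A)) ⊆
      Set.univ.pi I := by
  refine specHull_subset hI (fun i => ?_) fun i => ?_
  · rw [← Unitization.quasispectrum_eq_spectrum_inr' ℝ ℂ]
    exact (hx i).2.2
  · rw [← Unitization.quasispectrum_eq_spectrum_inr' ℝ ℂ]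
    exact (hy i).2.2

/-- This provides the point 0 ∈ K at which the affine minorant of f is taken. -/
theorem zero_mem_specBox_inr (x : Fin n → A) :
    (0 : Fin n → ℝ) ∈ specBox fun i => (x i : Unitization ℂ A) := by
  intro i _
  simp only [← Unitization.quasispectrum_eq_spectrum_inr' ℝ ℂ]
  exact quasispectrum.zero_mem ℝ (x i)

theorem specBox_inr_convexCombination_subset {x y : Fin n → A} (hx : ∀ i, IsSelfAdjoint (x i))
    (hy : ∀ i, IsSelfAdjoint (y i)) {a b : ℝ≥0} (hab : a + b = 1) :
    (specBox fun i => ((a • x + b • y) i : Unitization ℂ A)) ⊆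
      specHull (fun i => (x i : Unitization ℂ A)) fun i => (y i : Unitization ℂ A) := by
  rw [inr_convexCombination]
  exact specBox_convexCombination_subset_specHull (fun i => (hx i).inr ℂ) (fun i => (hy i).inr ℂ)
    hab

variable [PartialOrder A] [StarOrderedRing A] {τ : A → ℝ≥0∞}

theorem convexOn_realTrace_jointCFCₙ (hI : ∀ i, (I i).OrdConnected)
    (hf : ContinuousOn f (Set.univ.pi I)) (hconv : ConvexOn ℝ (Set.univ.pi I) f) (hf0 : f 0 = 0)
    (hS : MutuallyCommuting S) (hτ : IsTrace τ) (hfin : IsFiniteTrace τ) :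
    ConvexOn ℝ (saTuplesₙ S I) fun x => realTrace τ (jointCFCₙ x f) := by
  refine convexOn_real_iff_nnreal.mpr ⟨convex_saTuplesₙ hI S, fun x hx y hy a b ha hb hab => ?_⟩
  have hz := convex_saTuplesₙ hI S hx hy ha hb hab
  have hxI := specHull_inr_subset hI hx hy
  exact realTrace_jointCFCₙ_convexCombination_le hτ hfin
    (isCommSelfAdjoint_of_mem hS (fun i => (hx i).1) fun i => (hx i).2.1)
    (isCommSelfAdjoint_of_mem hS (fun i => (hy i).1) fun i => (hy i).2.1)
    (isCommSelfAdjoint_of_mem hS (fun i => (hz i).1) fun i => (hz i).2.1) hab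
    (isCompact_specHull _ _) (specBox_subset_specHull_left _ _ (zero_mem_specBox_inr x))
    (specBox_subset_specHull_left _ _) (specBox_subset_specHull_right _ _)
    (specBox_inr_convexCombination_subset (fun i => (hx i).2.1) (fun i => (hy i).2.1) hab)
    (hf.mono hxI) (hconv.subset hxI (convex_specHull _ _)) hf0

theorem convexOn_trace_jointCFCₙ (hI : ∀ i, (I i).OrdConnected)
    (hf : ContinuousOn f (Set.univ.pi I)) (hconv : ConvexOn ℝ (Set.univ.pi I) f) (hf0 : f 0 = 0)
    (hpos : ∀ t ∈ Set.univ.pi I, 0 ≤ f t) (hS : MutuallyCommuting S) (hτ : IsTrace τ)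
    (hlsc : LowerSemicontinuousOn τ {a | 0 ≤ a}) :
    ConvexOn ℝ≥0 (saTuplesₙ S I) fun x => τ (jointCFCₙ x f) := by
  refine ⟨convex_saTuplesₙ hI S, fun x hx y hy a b ha hb hab => ?_⟩
  have hz := convex_saTuplesₙ hI S hx hy ha hb hab
  have hxI := specHull_inr_subset hI hx hy
  exact trace_jointCFCₙ_convexCombination_le hτ hlsc
    (isCommSelfAdjoint_of_mem hS (fun i => (hx i).1) fun i => (hx i).2.1)
    (isCommSelfAdjoint_of_mem hS (fun i => (hy i).1) fun i => (hy i).2.1)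
    (isCommSelfAdjoint_of_mem hS (fun i => (hz i).1) fun i => (hz i).2.1) hab
    (isCompact_specHull _ _) (specBox_subset_specHull_left _ _)
    (specBox_subset_specHull_right _ _)
    (specBox_inr_convexCombination_subset (fun i => (hx i).2.1) (fun i => (hy i).2.1) hab)
    (hf.mono hxI) (hconv.subset hxI (convex_specHull _ _)) (fun t ht => hpos t (hxI ht)) hf0

end NonUnital

end Tuples

end TraceConvexity

end

/-! ### The main theorem -/

open TraceConvexity in
theorem theorem2 {n : ℕ} (I : Fin n → Set ℝ) (hI : ∀ i, (I i).OrdConnected)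
    (f : (Fin n → ℝ) → ℝ) (hf : ContinuousOn f (Set.univ.pi I))
    (hconv : ConvexOn ℝ (Set.univ.pi I) f) :
    -- unital C⋆-algebras
    (∀ (A : Type*) [CStarAlgebra A] [PartialOrder A] [StarOrderedRing A]
      (S : Fin n → NonUnitalStarSubalgebra ℂ A), (∀ i, IsClosed (S i : Set A)) →
      MutuallyCommuting S → ∀ τ : A → ℝ≥0∞, IsTrace τ →
        (IsFiniteTrace τ →
          ConvexOn ℝ (saTuples S I) fun x => realTrace τ (jointCFC x f)) ∧
        (IsDenselyDefined τ → LowerSemicontinuousOn τ {a | 0 ≤ a} →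
          (∀ t ∈ Set.univ.pi I, 0 ≤ f t) →
          ConvexOn ℝ≥0 (saTuples S I) fun x => τ (jointCFC x f))) ∧
    -- C⋆-algebras without unit, where `f(x) ∈ A` requires `f 0 = 0`
    (f 0 = 0 → ∀ (A : Type*) [NonUnitalCStarAlgebra A] [PartialOrder A] [StarOrderedRing A]
      (S : Fin n → NonUnitalStarSubalgebra ℂ A), (∀ i, IsClosed (S i : Set A)) →
      MutuallyCommuting S → ∀ τ : A → ℝ≥0∞, IsTrace τ →
        (IsFiniteTrace τ →
          ConvexOn ℝ (saTuplesₙ S I) fun x => realTrace τ (jointCFCₙ x f)) ∧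
        (IsDenselyDefined τ → LowerSemicontinuousOn τ {a | 0 ≤ a} →
          (∀ t ∈ Set.univ.pi I, 0 ≤ f t) →
          ConvexOn ℝ≥0 (saTuplesₙ S I) fun x => τ (jointCFCₙ x f))) := by
  refine ⟨?_, ?_⟩
  · intro A _ _ _ S _ hS τ hτ
    exact ⟨convexOn_realTrace_jointCFC hI hf hconv hS hτ,
      fun _ hlsc hpos => convexOn_trace_jointCFC hI hf hconv hpos hS hτ hlsc⟩
  · intro hf0 A _ _ _ S _ hS τ hτ
    exact ⟨convexOn_realTrace_jointCFCₙ hI hf hconv hf0 hS hτ,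
      fun _ hlsc hpos => convexOn_trace_jointCFCₙ hI hf hconv hf0 hpos hS hτ hlsc⟩
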